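/- Let $X$ be a finite-dimensional real Banach space with dual $X^*$, let $X_+\subset X$ be a nonempty closed convex cone, and let $Y_+=\{p\in X^*:\langle p,x\rangle\ge 0\ \forall x\in X_+\}$. Let $u:X\to\overline{\mathbb R}$ be finite at every point of $X_+$. For $p\in Y_+$ put $B(p)=\{x\in X_+:\langle p,x\rangle\le 1\}$, and put $B(p)=\emptyset$ for $p\in X^*\setminus Y_+$. For $p\in X^*$ let $v(p)=\sup\{u(x):x\in B(p)\}$ (with $\sup\emptyset=-\infty$) and $D(p)=\{x\in B(p):u(x)=v(p)\}$. For a subset $\Omega$ of a Banach space and $x\in\Omega$, $\varepsilon\ge0$, let $\widehat N_\varepsilon(x;\Omega)$ be the set of all $x^*$ with $\limsup_{y\to x,\ y\in\Omega}\langle x^*,y-x\rangle/\|y-x\|\le\varepsilon$. Let $N(\bar x;\Omega)$, $\bar x\in\Omega$, be the limiting (Mordukhovich) normal cone: the set of all $x^*$ for which there are $\varepsilon_k\downarrow0$, $x_k\to\bar x$ in $\Omega$ and $x_k^*\to x^*$ weakly* with $x_k^*\in\widehat N_{\varepsilon_k}(x_k;\Omega)$ for all $k$. For an extended-real-valued function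 $\varphi$ that is finite at $\bar x$, let $\partial\varphi(\bar x)=\{x^*:(x^*,-1)\in N((\bar x,\varphi(\bar x));\operatorname{epi}\varphi)\}$ and $\partial^\infty\varphi(\bar x)=\{x^*:(x^*,0)\in N((\bar x,\varphi(\bar x));\operatorname{epi}\varphi)\}$; both sets are empty if $\varphi(\bar x)$ is infinite. Let $\partial^+\varphi(\bar x)=-\partial(-\varphi)(\bar x)$ and $\partial^{\infty,+}\varphi(\bar x)=-\partial^\infty(-\varphi)(\bar x)$. Assume that $u$ is upper semicontinuous on $X_+$ (that is, the restriction $u|_{X_+}$ is upper semicontinuous) and that the non-satiety condition holds: whenever $x\in X_+$, $p\in Y_+$ and $\langle p,x\rangle<1$, there is $x'\in B(p)$ with $u(x')>u(x)$. Let $\bar p\in\operatorname{int}Y_+$ be such that, for every $\bar x\in D(\bar p)$, the function $u$ is upper semicontinuous (as a function on $X$) at every point of some neighborhood of $\bar x$ in $X$, and $$\partial^{\infty,+}u(\bar x)\cap N(\bar x;X_+)=\{0\}.$$ Then, with $X^{**}$ identified with $X$, $$\partial(-v)(\bar p)\subset\bigcup_{\bar x\in D(\bar p)}\ \bigcup_{x^*\in\partial^+u(\bar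 x)}\{\lambda\bar x:\lambda\ge0,\ x^*-\lambda\bar p\in N(\bar x;X_+)\},$$ $$\partial^\infty(-v)(\bar p)\subset\bigcup_{\bar x\in D(\bar p)}\ \bigcup_{x^*\in\partial^{\infty,+}u(\bar x)}\{\lambda\bar x:\lambda\ge0,\ x^*-\lambda\bar p\in N(\bar x;X_+)\}.$$ -/

import Mathlib

open Filter Topology
open scoped Pointwise

noncomputable section

namespace ConsumerProblem

section VariationalAnalysis

variable {E : Type*} [NormedAddCommGroup E] [NormedSpace ℝ E]

/-- The set of `ε`-normals to `Ω` at `x`: empty if `x ∉ Ω`, and otherwise the set of all `f` with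
`limsup ⟨f, y - x⟩ / ‖y - x‖ ≤ ε` as `y → x`, `y ∈ Ω` (written out with `ε + η`, `η > 0`; see
`mem_epsNormals_iff_limsup` for the form with the upper limit). -/
def epsNormals (ε : ℝ) (x : E) (Ω : Set E) : Set (StrongDual ℝ E) :=
  {f | x ∈ Ω ∧ ∀ η > 0, ∀ᶠ y in 𝓝[Ω] x, f (y - x) ≤ (ε + η) * ‖y - x‖}

theorem mem_epsNormals_iff_limsup {ε : ℝ} {x : E} {Ω : Set E} {f : StrongDual ℝ E} (hx : x ∈ Ω) :
    f ∈ epsNormals ε x Ω ↔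
      limsup (fun y => ((f (y - x) / ‖y - x‖ : ℝ) : EReal)) (𝓝[Ω \ {x}] x) ≤ (ε : EReal) := by
  have key : ∀ c : ℝ, (∀ᶠ y in 𝓝[Ω] x, f (y - x) ≤ c * ‖y - x‖) ↔
      ∀ᶠ y in 𝓝[Ω \ {x}] x, f (y - x) / ‖y - x‖ ≤ c := by
    intro c
    rw [eventually_nhdsWithin_iff, eventually_nhdsWithin_iff]
    refine eventually_congr (Eventually.of_forall fun y => ?_)
    by_cases hy : y = x
    · simp [hy]
    · have : 0 < ‖y - x‖ := norm_pos_iff.2 (sub_ne_zero.2 hy)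
      simp [hy, div_le_iff₀ this]
  constructor
  · rintro ⟨-, h⟩
    refine EReal.le_of_forall_lt_iff_le.1 fun c hc => ?_
    have hc' : 0 < c - ε := sub_pos.2 (EReal.coe_lt_coe_iff.1 hc)
    have h1 := (key _).1 (h (c - ε) hc')
    refine limsup_le_of_le (by isBoundedDefault) (h1.mono fun y hy => ?_)
    exact EReal.coe_le_coe_iff.2 (by linarith)
  · intro h
    refine ⟨hx, fun η hη => (key _).2 ?_⟩
    have h1 : limsup (fun y => ((f (y - x) / ‖y - x‖ : ℝ) : EReal)) (𝓝[Ω \ {x}] x)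
        < ((ε + η : ℝ) : EReal) := lt_of_le_of_lt h (EReal.coe_lt_coe_iff.2 (by linarith))
    exact (eventually_lt_of_limsup_lt h1 (by isBoundedDefault)).mono
      fun y hy => (EReal.coe_lt_coe_iff.1 hy).le

/-- The limiting (Mordukhovich) normal cone `N(x; Ω)`; empty if `x ∉ Ω`. Weak* convergence of a
sequence of functionals is pointwise convergence. This cone depends on the norm of `E` only through
its equivalence class, so that on a product any of the usual norms may be used. -/
def limitingNormalCone (x : E) (Ω : Set E) : Set (StrongDual ℝ E) :=
  {f | x ∈ Ω ∧ ∃ (ε : ℕ → ℝ) (z : ℕ → E) (g : ℕ → StrongDual ℝ E),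
    (∀ k, 0 ≤ ε k) ∧ Tendsto ε atTop (𝓝 0) ∧
    (∀ k, z k ∈ Ω) ∧ Tendsto z atTop (𝓝 x) ∧
    (∀ w : E, Tendsto (fun k => g k w) atTop (𝓝 (f w))) ∧
    ∀ k, g k ∈ epsNormals (ε k) (z k) Ω}

/-- The epigraph of an extended real-valued function, as a subset of `E × ℝ`. -/
def epi (φ : E → EReal) : Set (E × ℝ) := {q | φ q.1 ≤ (q.2 : EReal)}

/-- The functional `(x, μ) ↦ ⟨f, x⟩ + c μ` on `E × ℝ`, written `(f, c)` on paper. -/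
def pairFunctional (f : StrongDual ℝ E) (c : ℝ) : StrongDual ℝ (E × ℝ) :=
  f.coprod (c • ContinuousLinearMap.id ℝ ℝ)

/-- The limiting (Mordukhovich) subdifferential `∂φ(x)`; empty if `φ x` is infinite. -/
def limitingSubdiff (φ : E → EReal) (x : E) : Set (StrongDual ℝ E) :=
  {f | φ x ≠ ⊤ ∧ φ x ≠ ⊥ ∧
    pairFunctional f (-1) ∈ limitingNormalCone (x, (φ x).toReal) (epi φ)}

/-- The singular subdifferential `∂^∞ φ(x)`; empty if `φ x` is infinite. -/
def singularSubdiff (φ : E → EReal) (x : E) : Set (StrongDual ℝ E) :=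
  {f | φ x ≠ ⊤ ∧ φ x ≠ ⊥ ∧
    pairFunctional f 0 ∈ limitingNormalCone (x, (φ x).toReal) (epi φ)}

/-- The limiting upper subdifferential `∂⁺φ(x) = -∂(-φ)(x)`. -/
def limitingUpperSubdiff (φ : E → EReal) (x : E) : Set (StrongDual ℝ E) :=
  -limitingSubdiff (fun y => -φ y) x

/-- The singular upper subdifferential `∂^{∞,+}φ(x) = -∂^∞(-φ)(x)`. -/
def singularUpperSubdiff (φ : E → EReal) (x : E) : Set (StrongDual ℝ E) :=
  -singularSubdiff (fun y => -φ y) x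

end VariationalAnalysis

section Consumer

variable {X : Type*} [NormedAddCommGroup X] [NormedSpace ℝ X]

/-- The set of prices `Y₊`: the positive dual cone of the cone `C` of goods. -/
def prices (C : ProperCone ℝ X) : Set (StrongDual ℝ X) :=
  {p | ∀ x ∈ C, 0 ≤ p x}

/-- The budget map `B`, empty outside `Y₊`. -/
def budget (C : ProperCone ℝ X) (p : StrongDual ℝ X) : Set X :=
  {x | p ∈ prices C ∧ x ∈ C ∧ p x ≤ 1}

/-- The indirect utility function `v(p) = sup {u(x) : x ∈ B(p)}`, with `sup ∅ = -∞`. -/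
def indirectUtility (C : ProperCone ℝ X) (u : X → EReal) (p : StrongDual ℝ X) : EReal :=
  ⨆ x ∈ budget C p, u x

/-- The demand map `D`, empty outside `Y₊`. -/
def demand (C : ProperCone ℝ X) (u : X → EReal) (p : StrongDual ℝ X) : Set X :=
  {x | x ∈ budget C p ∧ u x = indirectUtility C u p}

/-- The non-satiety condition: a bundle that does not exhaust the income can be improved upon
within the budget. -/
def NonSatiety (C : ProperCone ℝ X) (u : X → EReal) : Prop :=
  ∀ x ∈ C, ∀ p ∈ prices C, p x < 1 → ∃ x' ∈ budget C p, u x < u x'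

/-- The qualification condition `∂^{∞,+}u(x) ∩ N(x; X₊) = {0}`. -/
def Qualification (C : ProperCone ℝ X) (u : X → EReal) (x : X) : Prop :=
  singularUpperSubdiff u x ∩ limitingNormalCone x (C : Set X) = {0}

end Consumer

end ConsumerProblem

end

namespace ConsumerProblem

section EpsNormals

variable {E F : Type*} [NormedAddCommGroup E] [NormedSpace ℝ E]
  [NormedAddCommGroup F] [NormedSpace ℝ F]

theorem smul_mem_epsNormals {ε c : ℝ} {x : E} {Ω : Set E} {f : StrongDual ℝ E}
    (hf : f ∈ epsNormals ε x Ω) (hc : 0 < c) : c • f ∈ epsNormals (c * ε) x Ω := by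
  refine ⟨hf.1, fun η hη => ?_⟩
  filter_upwards [hf.2 (η / c) (by positivity)] with y hy
  have h := mul_le_mul_of_nonneg_left hy hc.le
  have e : c * ((ε + η / c) * ‖y - x‖) = (c * ε + η) * ‖y - x‖ := by field_simp
  simpa [e] using h

theorem mem_epsNormals_of_eventually_le_add_sq {ε M : ℝ} {x : E} {Ω : Set E} {f : StrongDual ℝ E}
    (hx : x ∈ Ω) (h : ∀ᶠ y in 𝓝[Ω] x, f (y - x) ≤ ε * ‖y - x‖ + M * ‖y - x‖ ^ 2) :
    f ∈ epsNormals ε x Ω := by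
  refine ⟨hx, fun η hη => ?_⟩
  have hlim : Tendsto (fun y => M * ‖y - x‖) (𝓝[Ω] x) (𝓝 0) := by
    have : Continuous fun y => M * ‖y - x‖ := by fun_prop
    simpa using (this.tendsto x).mono_left nhdsWithin_le_nhds
  filter_upwards [h, hlim.eventually_lt_const hη] with y h1 h2
  nlinarith [norm_nonneg (y - x)]

/-- Pulling back `ε`-normals along a map that is differentiable at the point. -/
theorem comp_mem_epsNormals {ε M : ℝ} {x : E} {Ω : Set E} {Θ : Set F} {G : E → F} {G' : E →L[ℝ] F}
    {f : StrongDual ℝ F} (hε : 0 ≤ ε) (hf : f ∈ epsNormals ε (G x) Θ) (hG : HasFDerivAt G G' x)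
    (hM : ‖G'‖ ≤ M) (hx : x ∈ Ω) (hmaps : ∀ᶠ y in 𝓝[Ω] x, G y ∈ Θ) :
    f.comp G' ∈ epsNormals (ε * M) x Ω := by
  refine ⟨hx, fun η hη => ?_⟩
  have hM0 : 0 ≤ M := (norm_nonneg _).trans hM
  obtain ⟨τ, hτ0, hτ⟩ : ∃ τ > 0, (ε + τ) * (M + τ) + ‖f‖ * τ < ε * M + η := by
    have hc : Continuous fun τ : ℝ => (ε + τ) * (M + τ) + ‖f‖ * τ := by fun_prop
    have h0 : ∀ᶠ τ in 𝓝[>] (0 : ℝ), (ε + τ) * (M + τ) + ‖f‖ * τ < ε * M + η :=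
      nhdsWithin_le_nhds ((hc.tendsto 0).eventually_lt_const (by simpa using hη))
    obtain ⟨τ, h1, h2⟩ := (h0.and self_mem_nhdsWithin).exists
    exact ⟨τ, h2, h1⟩
  have htend : Tendsto G (𝓝[Ω] x) (𝓝[Θ] (G x)) :=
    tendsto_nhdsWithin_iff.2 ⟨hG.continuousAt.tendsto.mono_left nhdsWithin_le_nhds, hmaps⟩
  have ho := (hasFDerivAt_iff_isLittleO.1 hG).def hτ0
  filter_upwards [htend.eventually (hf.2 τ hτ0), nhdsWithin_le_nhds ho] with y h1 h2
  have h3 : ‖G y - G x‖ ≤ (M + τ) * ‖y - x‖ := by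
    calc ‖G y - G x‖ = ‖G' (y - x) + (G y - G x - G' (y - x))‖ := by congr 1; abel
      _ ≤ ‖G' (y - x)‖ + ‖G y - G x - G' (y - x)‖ := norm_add_le _ _
      _ ≤ M * ‖y - x‖ + τ * ‖y - x‖ :=
        add_le_add (G'.le_of_opNorm_le hM _) h2
      _ = _ := by ring
  have h4 : f (G' (y - x)) ≤ f (G y - G x) + ‖f‖ * (τ * ‖y - x‖) := by
    have e : f (G' (y - x)) = f (G y - G x) - f (G y - G x - G' (y - x)) := by
      rw [← map_sub]; congr 1; abel
    have := (abs_le.1 ((f.le_opNorm (G y - G x - G' (y - x))))).1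
    have := mul_le_mul_of_nonneg_left h2 (norm_nonneg f)
    linarith
  have h5 := mul_le_mul_of_nonneg_left h3 (add_pos_of_nonneg_of_pos hε hτ0).le
  have h6 := mul_le_mul_of_nonneg_right hτ.le (norm_nonneg (y - x))
  calc f (G' (y - x)) ≤ (ε + τ) * ((M + τ) * ‖y - x‖) + ‖f‖ * (τ * ‖y - x‖) := by linarith
    _ = ((ε + τ) * (M + τ) + ‖f‖ * τ) * ‖y - x‖ := by ring
    _ ≤ _ := h6

end EpsNormals

section LimitingNormalCone

variable {E F : Type*} [NormedAddCommGroup E] [NormedSpace ℝ E]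
  [NormedAddCommGroup F] [NormedSpace ℝ F]

theorem tendsto_clm_apply {ι : Type*} {l : Filter ι} {f : ι → E →L[ℝ] F} {f₀ : E →L[ℝ] F}
    {x : ι → E} {x₀ : E} (hf : Tendsto f l (𝓝 f₀)) (hx : Tendsto x l (𝓝 x₀)) :
    Tendsto (fun k => f k (x k)) l (𝓝 (f₀ x₀)) :=
  (isBoundedBilinearMap_apply.continuous.tendsto (f₀, x₀)).comp (hf.prodMk_nhds hx)

theorem tendsto_dual_of_tendsto_apply [FiniteDimensional ℝ E] {ι : Type*} {l : Filter ι}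
    {g : ι → StrongDual ℝ E} {f : StrongDual ℝ E}
    (h : ∀ w, Tendsto (fun k => g k w) l (𝓝 (f w))) : Tendsto g l (𝓝 f) := by
  let b := Module.finBasis ℝ E
  let Φ : StrongDual ℝ E →ₗ[ℝ] (Fin (Module.finrank ℝ E) → ℝ) :=
    { toFun := fun f i => f (b i)
      map_add' := fun _ _ => rfl
      map_smul' := fun _ _ => rfl }
  have hΦ : LinearMap.ker Φ = ⊥ := by
    refine LinearMap.ker_eq_bot'.2 fun f hf => ?_
    have : (f : E →ₗ[ℝ] ℝ) = 0 := b.ext fun i => congrFun hf i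
    exact ContinuousLinearMap.coe_injective this
  rw [(LinearMap.isClosedEmbedding_of_injective hΦ).isInducing.tendsto_nhds_iff, tendsto_pi_nhds]
  exact fun i => h (b i)

/-- In the definition of the limiting normal cone it is enough to control a subsequence. -/
theorem mem_limitingNormalCone_of_tendsto {x : E} {Ω : Set E} {f : StrongDual ℝ E} (hx : x ∈ Ω)
    {ε : ℕ → ℝ} {z : ℕ → E} {g : ℕ → StrongDual ℝ E} (hε0 : ∀ k, 0 ≤ ε k)
    (hε : Tendsto ε atTop (𝓝 0)) (hz : Tendsto z atTop (𝓝 x)) (hg : Tendsto g atTop (𝓝 f))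
    (h : ∃ᶠ k in atTop, g k ∈ epsNormals (ε k) (z k) Ω) : f ∈ limitingNormalCone x Ω := by
  obtain ⟨φ, hφ, hφ'⟩ := extraction_of_frequently_atTop h
  have ht := hφ.tendsto_atTop
  exact ⟨hx, ε ∘ φ, z ∘ φ, g ∘ φ, fun k => hε0 _, hε.comp ht, fun k => (hφ' k).1, hz.comp ht,
    fun w => (((ContinuousLinearMap.apply ℝ ℝ w).continuous.tendsto f).comp hg).comp ht, hφ'⟩

/-- Fuzzy intersection rule: an `ε`-normal to `Ω ∩ π⁻¹(Θ)` is, up to an arbitrarily small error, a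
sum of normals to `Ω` and to `Θ` at nearby points. -/
theorem exists_epsNormals_of_mem_epsNormals_inter_preimage [FiniteDimensional ℝ E]
    [FiniteDimensional ℝ F] (π : E →L[ℝ] F) {Ω K : Set E} {Θ : Set F} {y : E} {ε δ : ℝ}
    {g : StrongDual ℝ E} (hg : g ∈ epsNormals ε y (Ω ∩ π ⁻¹' Θ)) (hK : K ∈ 𝓝 y)
    (hΩ : IsClosed (Ω ∩ K)) (hΘ : IsClosed Θ) (hεδ : 0 ≤ ε + δ)
    (hδ : 0 < δ) :
    ∃ z w, ∃ a : StrongDual ℝ F, dist z y < δ ∧ dist w (π y) < δ ∧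
      g - a.comp π ∈ epsNormals (ε + δ) z Ω ∧ a ∈ epsNormals 0 w Θ := by
  let L := (toEuclidean (E := F)).toContinuousLinearMap
  obtain ⟨⟨hyΩ, hyΘ⟩, hN⟩ := hg
  obtain ⟨r, hr0, hrK, hrN⟩ : ∃ r > 0, Metric.closedBall y r ⊆ K ∧ r < δ ∧
      ∀ z ∈ Metric.closedBall y r, z ∈ Ω ∩ π ⁻¹' Θ → g (z - y) ≤ (ε + δ / 2) * ‖z - y‖ := by
    obtain ⟨r, hr, h⟩ := Metric.nhds_basis_closedBall.mem_iff.1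
      (inter_mem hK (eventually_nhdsWithin_iff.1 (hN (δ / 2) (half_pos hδ))))
    refine ⟨min r (δ / 2), lt_min hr (half_pos hδ), ?_, ?_, ?_⟩
    · exact fun z hz => (h (Metric.closedBall_subset_closedBall (min_le_left _ _) hz)).1
    · exact (min_le_right _ _).trans_lt (half_lt_self hδ)
    · exact fun z hz => (h (Metric.closedBall_subset_closedBall (min_le_left _ _) hz)).2
  obtain ⟨hrδ, hrN⟩ := hrN
  have hA : IsCompact (Ω ∩ Metric.closedBall y r) := by
    have e : Ω ∩ Metric.closedBall y r = (Ω ∩ K) ∩ Metric.closedBall y r := by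
      rw [Set.inter_assoc, Set.inter_eq_right.2 hrK]
    rw [e]
    exact (isCompact_closedBall y r).inter_left hΩ
  have hB : IsCompact (Θ ∩ Metric.closedBall (π y) (δ / 2)) :=
    (isCompact_closedBall _ _).inter_left hΘ
  have hAB := hA.prod hB
  have hymem : (y, π y) ∈ (Ω ∩ Metric.closedBall y r) ×ˢ (Θ ∩ Metric.closedBall (π y) (δ / 2)) :=
    ⟨⟨hyΩ, Metric.mem_closedBall_self hr0.le⟩, hyΘ, Metric.mem_closedBall_self (half_pos hδ).le⟩
  let ψ : E → ℝ := fun z => -g (z - y) + (ε + δ) * ‖z - y‖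
  have hψ : Continuous ψ := by fun_prop
  have hmin : ∀ n : ℕ, ∃ q ∈ (Ω ∩ Metric.closedBall y r) ×ˢ (Θ ∩ Metric.closedBall (π y) (δ / 2)),
      IsMinOn (fun q : E × F => ψ q.1 + n * ‖L (π q.1 - q.2)‖ ^ 2)
        ((Ω ∩ Metric.closedBall y r) ×ˢ (Θ ∩ Metric.closedBall (π y) (δ / 2))) q := fun n =>
    hAB.exists_isMinOn ⟨_, hymem⟩ (Continuous.continuousOn (by fun_prop))
  choose q hq hqmin using hmin
  have hle : ∀ n : ℕ, ψ (q n).1 + n * ‖L (π (q n).1 - (q n).2)‖ ^ 2 ≤ 0 := fun n => by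
    simpa [ψ] using isMinOn_iff.1 (hqmin n) _ hymem
  obtain ⟨⟨z, w⟩, ⟨hz, hw⟩, φ, hφ, hφq⟩ := hAB.tendsto_subseq hq
  have hzt : Tendsto (fun k => (q (φ k)).1) atTop (𝓝 z) := (continuous_fst.tendsto _).comp hφq
  have hwt : Tendsto (fun k => (q (φ k)).2) atTop (𝓝 w) := (continuous_snd.tendsto _).comp hφq
  have hψt := (hψ.tendsto z).comp hzt
  have hψz : ψ z ≤ 0 := le_of_tendsto' hψt fun k => by
    have := hle (φ k)
    have : 0 ≤ (φ k : ℝ) * ‖L (π (q (φ k)).1 - (q (φ k)).2)‖ ^ 2 := by positivity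
    simp only [Function.comp]
    linarith
  have hzw : π z = w := by
    have h0 : Tendsto (fun k => -ψ (q (φ k)).1 * (φ k : ℝ)⁻¹) atTop (𝓝 0) := by
      simpa using hψt.neg.mul (tendsto_inv_atTop_nhds_zero_nat.comp hφ.tendsto_atTop)
    have h1 : Tendsto (fun k => ‖L (π (q (φ k)).1 - (q (φ k)).2)‖ ^ 2) atTop
        (𝓝 (‖L (π z - w)‖ ^ 2)) :=
      (L.continuous.tendsto _ |>.comp
        (((π.continuous.tendsto z).comp hzt).sub hwt)).norm.pow 2
    have h2 : ‖L (π z - w)‖ ^ 2 ≤ 0 := by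
      refine le_of_tendsto_of_tendsto h1 h0 ?_
      filter_upwards [hφ.tendsto_atTop.eventually_gt_atTop 0] with k hk
      have hk' : (0 : ℝ) < φ k := by exact_mod_cast hk
      rw [← div_eq_mul_inv, le_div_iff₀ hk']
      linarith [hle (φ k)]
    have h3 : L (π z - w) = 0 := norm_eq_zero.1 (pow_eq_zero_iff two_ne_zero |>.1
      (le_antisymm h2 (by positivity)))
    exact sub_eq_zero.1 (toEuclidean.map_eq_zero_iff.1 h3)
  have hzy : z = y := by
    have h1 := hrN z hz.2 ⟨hz.1, by rw [Set.mem_preimage, hzw]; exact hw.1⟩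
    have h2 : -g (z - y) + (ε + δ) * ‖z - y‖ ≤ 0 := hψz
    have h3 : ‖z - y‖ ≤ 0 := by nlinarith
    exact sub_eq_zero.1 (norm_le_zero_iff.1 h3)
  subst hzw hzy
  obtain ⟨k, hk1, hk2⟩ := ((hzt.eventually (Metric.ball_mem_nhds z hr0)).and
    (hwt.eventually (Metric.ball_mem_nhds (π z) (half_pos hδ)))).exists
  generalize φ k = n at hk1 hk2
  obtain ⟨⟨⟨hq1, -⟩, hq2, -⟩, hm⟩ := And.intro (hq n) (isMinOn_iff.1 (hqmin n))
  generalize (q n).1 = z' at hk1 hq1 hm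
  generalize (q n).2 = w' at hk2 hq2 hm
  let a : StrongDual ℝ F := (2 * n : ℝ) • (innerSL ℝ (L (π z' - w'))).comp L
  refine ⟨z', w', a, (Metric.mem_ball.1 hk1).trans hrδ,
    (Metric.mem_ball.1 hk2).trans (half_lt_self hδ), ?_, ?_⟩
  · refine mem_epsNormals_of_eventually_le_add_sq (M := n * ‖L.comp π‖ ^ 2) hq1 ?_
    filter_upwards [self_mem_nhdsWithin, nhdsWithin_le_nhds (Metric.isOpen_ball.mem_nhds hk1)]
      with x hxΩ hxb
    have h := hm (x, w') ⟨⟨hxΩ, Metric.ball_subset_closedBall hxb⟩, hq2,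
      Metric.ball_subset_closedBall hk2⟩
    have e1 : L (π x - w') = L (π z' - w') + L (π (x - z')) := by
      rw [map_sub π, ← map_add]; congr 1; abel
    have e2 : g (x - z) = g (x - z') + g (z' - z) := by rw [← map_add]; congr 1; abel
    have h1 : ‖x - z‖ ≤ ‖x - z'‖ + ‖z' - z‖ := norm_sub_le_norm_sub_add_norm_sub _ _ _
    have h2 : ‖L (π (x - z'))‖ ^ 2 ≤ ‖L.comp π‖ ^ 2 * ‖x - z'‖ ^ 2 := by
      rw [← mul_pow]; exact pow_le_pow_left₀ (norm_nonneg _) ((L.comp π).le_opNorm _) 2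
    have h3 := mul_le_mul_of_nonneg_left h2 (Nat.cast_nonneg (α := ℝ) n)
    have h4 := mul_le_mul_of_nonneg_left h1 hεδ
    simp only [e1, norm_add_sq_real, ψ, e2] at h
    simp only [a, sub_apply, ContinuousLinearMap.comp_apply, smul_apply, smul_eq_mul,
      innerSL_apply_apply]
    linarith
  · refine mem_epsNormals_of_eventually_le_add_sq (M := n * ‖L‖ ^ 2) hq2 ?_
    filter_upwards [self_mem_nhdsWithin, nhdsWithin_le_nhds (Metric.isOpen_ball.mem_nhds hk2)]
      with x hxΘ hxb
    have h := hm (z', x) ⟨⟨hq1, Metric.ball_subset_closedBall hk1⟩, hxΘ,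
      Metric.ball_subset_closedBall hxb⟩
    have e1 : L (π z' - x) = L (π z' - w') - L (x - w') := by
      rw [← map_sub]; congr 1; abel
    have h2 : ‖L (x - w')‖ ^ 2 ≤ ‖L‖ ^ 2 * ‖x - w'‖ ^ 2 := by
      rw [← mul_pow]; exact pow_le_pow_left₀ (norm_nonneg _) (L.le_opNorm _) 2
    have h3 := mul_le_mul_of_nonneg_left h2 (Nat.cast_nonneg (α := ℝ) n)
    simp only [e1, norm_sub_sq_real] at h
    simp only [a, ContinuousLinearMap.comp_apply, smul_apply, smul_eq_mul,
      innerSL_apply_apply]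
    linarith

/-- Intersection rule for limiting normals, under a qualification condition. -/
theorem exists_sub_comp_mem_limitingNormalCone [FiniteDimensional ℝ E] [FiniteDimensional ℝ F]
    (π : E →L[ℝ] F) {Ω K : Set E} {Θ : Set F} {y : E} {g : StrongDual ℝ E}
    (hg : g ∈ limitingNormalCone y (Ω ∩ π ⁻¹' Θ)) (hK : K ∈ 𝓝 y)
    (hΩ : IsClosed (Ω ∩ K)) (hΘ : IsClosed Θ)
    (hqual : ∀ a ∈ limitingNormalCone (π y) Θ, -a.comp π ∈ limitingNormalCone y Ω → a = 0) :
    ∃ a ∈ limitingNormalCone (π y) Θ, g - a.comp π ∈ limitingNormalCone y Ω := by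
  obtain ⟨hy, ε, z, g', hε0, hε, -, hz, hg', hN⟩ := hg
  replace hg' := tendsto_dual_of_tendsto_apply hg'
  have hKz : ∀ᶠ k in atTop, K ∈ 𝓝 (z k) := hz.eventually (eventually_mem_nhds_iff.2 hK)
  obtain ⟨N, hN'⟩ := eventually_atTop.1 hKz
  have hadd : Tendsto (fun k => k + N) atTop atTop := tendsto_add_atTop_nat N
  let δ : ℕ → ℝ := fun k => 1 / ((k : ℝ) + 1)
  have hδ0 : ∀ k, 0 < δ k := fun k => by positivity
  have hδ : Tendsto δ atTop (𝓝 0) := tendsto_one_div_add_atTop_nhds_zero_nat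
  choose z₁ w a hz₁ hw ha₁ ha₂ using fun k =>
    exists_epsNormals_of_mem_epsNormals_inter_preimage π (hN (k + N)) (hN' _ (Nat.le_add_left _ _))
      hΩ hΘ (add_nonneg (hε0 _) (hδ0 k).le) (hδ0 k)
  have hzN := hz.comp hadd
  have hz₁t : Tendsto z₁ atTop (𝓝 y) := by
    refine hzN.congr_dist (squeeze_zero (fun _ => dist_nonneg) (fun k => ?_) hδ)
    rw [dist_comm]; exact (hz₁ k).le
  have hwt : Tendsto w atTop (𝓝 (π y)) := by
    refine ((π.continuous.tendsto y).comp hzN).congr_dist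
      (squeeze_zero (fun _ => dist_nonneg) (fun k => ?_) hδ)
    rw [dist_comm]; exact (hw k).le
  have hεt : Tendsto (fun k => ε (k + N) + δ k) atTop (𝓝 0) := by
    simpa using (hε.comp hadd).add hδ
  have hgN := hg'.comp hadd
  have hcomp : Continuous fun b : StrongDual ℝ F => b.comp π := by fun_prop
  by_cases hb : ∃ R, ∃ᶠ k in atTop, ‖a k‖ ≤ R
  · obtain ⟨R, hR⟩ := hb
    obtain ⟨b, -, φ, hφ, hφb⟩ := tendsto_subseq_of_frequently_bounded
      (Metric.isBounded_closedBall (x := (0 : StrongDual ℝ F)) (r := R))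
      (hR.mono fun k hk => by simpa using hk)
    have ht := hφ.tendsto_atTop
    refine ⟨b, ?_, ?_⟩
    · exact mem_limitingNormalCone_of_tendsto hy.2 (fun _ => le_rfl) tendsto_const_nhds
        (hwt.comp ht) hφb (Frequently.of_forall fun k => ha₂ _)
    · exact mem_limitingNormalCone_of_tendsto hy.1
        (fun k => add_nonneg (hε0 _) (hδ0 _).le) (hεt.comp ht) (hz₁t.comp ht)
        ((hgN.comp ht).sub ((hcomp.tendsto b).comp hφb)) (Frequently.of_forall fun k => ha₁ _)
  · exfalso
    simp only [not_exists, not_frequently, not_le] at hb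
    have hat : Tendsto (fun k => ‖a k‖) atTop atTop :=
      tendsto_atTop.2 fun R => (hb R).mono fun k hk => hk.le
    have hinv : Tendsto (fun k => ‖a k‖⁻¹) atTop (𝓝 0) := hat.inv_tendsto_atTop
    have hpos : ∀ᶠ k in atTop, 0 < ‖a k‖ := hb 0
    obtain ⟨b, -, φ, hφ, hφb⟩ := tendsto_subseq_of_frequently_bounded
      (Metric.isBounded_sphere (x := (0 : StrongDual ℝ F)) (r := 1)) (x := fun k => ‖a k‖⁻¹ • a k)
      (hpos.mono fun k hk => by simp [norm_smul, hk.ne']).frequently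
    have ht := hφ.tendsto_atTop
    have hb1 : ‖b‖ = 1 := by
      refine tendsto_nhds_unique hφb.norm (tendsto_const_nhds.congr' ?_)
      filter_upwards [ht.eventually hpos] with k hk
      simp [norm_smul, hk.ne']
    have h1 : b ∈ limitingNormalCone (π y) Θ := by
      refine mem_limitingNormalCone_of_tendsto hy.2 (fun _ => le_rfl) tendsto_const_nhds
        (hwt.comp ht) hφb (Eventually.frequently ?_)
      filter_upwards [ht.eventually hpos] with k hk
      simpa using smul_mem_epsNormals (ha₂ (φ k)) (inv_pos.2 hk)
    have h2 : -b.comp π ∈ limitingNormalCone y Ω := by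
      refine mem_limitingNormalCone_of_tendsto hy.1 (z := z₁ ∘ φ)
        (ε := fun k => ‖a (φ k)‖⁻¹ * (ε (φ k + N) + δ (φ k)))
        (g := fun k => ‖a (φ k)‖⁻¹ • (g' (φ k + N) - (a (φ k)).comp π))
        (fun k => mul_nonneg (by positivity) (add_nonneg (hε0 _) (hδ0 _).le))
        (by simpa [Function.comp_def] using (hinv.mul hεt).comp ht) (hz₁t.comp ht) ?_ (Eventually.frequently ?_)
      · have := ((hinv.smul hgN).comp ht).sub ((hcomp.tendsto b).comp hφb)
        simpa [smul_sub, Function.comp_def] using this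
      · filter_upwards [ht.eventually hpos] with k hk
        exact smul_mem_epsNormals (ha₁ (φ k)) (inv_pos.2 hk)
    simp [hqual b h1 h2] at hb1

end LimitingNormalCone

section Epigraph

@[simp]
theorem pairFunctional_apply {E : Type*} [NormedAddCommGroup E] [NormedSpace ℝ E]
    (f : StrongDual ℝ E) (c : ℝ) (q : E × ℝ) :
    pairFunctional f c q = f q.1 + c * q.2 := rfl

theorem isClosed_epi_neg_inter {E : Type*} [NormedAddCommGroup E] {u : E → EReal} {K : Set E} (hK : IsClosed K)
    (hu : UpperSemicontinuousOn u K) :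
    IsClosed (epi (fun y => -u y) ∩ Prod.fst ⁻¹' K) := by
  have h := (upperSemicontinuousOn_iff_isClosed_hypograph hK).1 hu
  have hc : Continuous fun q : E × ℝ => (q.1, ((-q.2 : ℝ) : EReal)) :=
    continuous_fst.prodMk (continuous_coe_real_ereal.comp continuous_snd.neg)
  convert h.preimage hc using 1
  ext ⟨x, α⟩
  simp only [epi, Set.mem_inter_iff, Set.mem_ofPred_eq, Set.mem_preimage, EReal.coe_neg,
    and_comm, EReal.neg_le]

end Epigraph

section Consumer

variable {X : Type*} [NormedAddCommGroup X] [NormedSpace ℝ X] {C : ProperCone ℝ X} {u : X → EReal}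

theorem smul_mem_prices {q : StrongDual ℝ X} (hq : q ∈ prices C) {t : ℝ} (ht : 0 ≤ t) :
    t • q ∈ prices C := fun x hx => mul_nonneg ht (hq x hx)

theorem exists_norm_le_of_mem_interior_prices {p : StrongDual ℝ X} (hp : p ∈ interior (prices C)) :
    ∃ R, ∀ᶠ q in 𝓝 p, ∀ x ∈ C, q x ≤ 1 → ‖x‖ ≤ R := by
  obtain ⟨r, hr, h⟩ := Metric.mem_nhds_iff.1 (mem_interior_iff_mem_nhds.1 hp)
  refine ⟨(r / 2)⁻¹, ?_⟩
  filter_upwards [Metric.ball_mem_nhds p (half_pos hr)] with q hq x hx hqx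
  obtain ⟨f, hf, hfx⟩ := exists_dual_vector'' ℝ x
  have hmem : q - (r / 2) • f ∈ prices C := h <| by
    rw [mem_ball_iff_norm] at hq ⊢
    calc ‖q - (r / 2) • f - p‖ = ‖(q - p) - (r / 2) • f‖ := by congr 1; abel
      _ ≤ ‖q - p‖ + ‖(r / 2) • f‖ := norm_sub_le _ _
      _ < r / 2 + r / 2 := by
        refine add_lt_add_of_lt_of_le hq ?_
        rw [norm_smul, Real.norm_of_nonneg (by positivity)]
        exact mul_le_of_le_one_right (by positivity) hf
      _ = r := add_halves r
  have h0 := hmem x hx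
  simp only [sub_apply, smul_apply, smul_eq_mul, hfx, RCLike.ofReal_real_eq_id, id_eq] at h0
  rw [← one_div, le_div_iff₀ (half_pos hr)]
  linarith

theorem isCompact_budget [FiniteDimensional ℝ X] {q : StrongDual ℝ X} (hq : q ∈ interior (prices C)) :
    IsCompact (budget C q) := by
  obtain ⟨R, hR⟩ := exists_norm_le_of_mem_interior_prices hq
  have e : budget C q = (C : Set X) ∩ {x | q x ≤ 1} := by
    ext x; simp [budget, interior_subset hq]
  refine Metric.isCompact_of_isClosed_isBounded ?_ ?_
  · rw [e]
    exact C.isClosed.inter (isClosed_le q.continuous continuous_const)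
  · exact (Metric.isBounded_closedBall (x := (0 : X)) (r := R)).subset fun x hx => by
      simpa using hR.self_of_nhds x hx.2.1 hx.2.2

theorem demand_nonempty [FiniteDimensional ℝ X] (husc : UpperSemicontinuousOn u (C : Set X))
    {q : StrongDual ℝ X} (hq : q ∈ interior (prices C)) : (demand C u q).Nonempty := by
  obtain ⟨x, hx, hmax⟩ := UpperSemicontinuousOn.exists_isMaxOn
    (s := budget C q) ⟨0, interior_subset hq, C.zero_mem, by simp⟩ (isCompact_budget hq)
    (husc.mono fun x (hx : x ∈ budget C q) => hx.2.1)
  exact ⟨x, hx, le_antisymm (le_iSup₂ (f := fun x _ => u x) x hx) (iSup₂_le hmax)⟩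

theorem apply_eq_one_of_mem_demand (hnsc : NonSatiety C u) {q : StrongDual ℝ X} {x : X}
    (hx : x ∈ demand C u q) : q x = 1 := by
  refine hx.1.2.2.eq_of_not_lt fun hlt => ?_
  obtain ⟨y, hy, hxy⟩ := hnsc x hx.1.2.1 q hx.1.1 hlt
  exact (hxy.trans_le (le_iSup₂ (f := fun x _ => u x) y hy)).ne hx.2

theorem mem_epi_neg_indirectUtility {q : StrongDual ℝ X} {x : X} {α : ℝ} (hx : x ∈ budget C q)
    (hα : (x, α) ∈ epi fun y => -u y) : (q, α) ∈ epi fun q => -indirectUtility C u q :=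
  (EReal.neg_le_neg_iff.2 (le_iSup₂ (f := fun x _ => u x) x hx)).trans hα

/-- Normals to the epigraph of `-v` in the price directions which keep a demanded bundle
affordable. -/
theorem apply_le_of_mem_epsNormals {q r : StrongDual ℝ X} {x : X} {α ε : ℝ}
    {g : StrongDual ℝ (StrongDual ℝ X × ℝ)} (hq : q ∈ interior (prices C))
    (hx : x ∈ demand C u q)
    (hg : g ∈ epsNormals ε (q, α) (epi fun q => -indirectUtility C u q)) (hr : r x ≤ 0) :
    g (r, 0) ≤ ε * ‖r‖ := by
  have hα : (x, α) ∈ epi fun y => -u y := by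
    have := hg.1
    simpa only [epi, Set.mem_ofPred_eq, hx.2] using this
  refine le_of_forall_pos_le_add fun τ hτ => ?_
  have hlim : Tendsto (fun t : ℝ => (q + t • r, α)) (𝓝[>] 0) (𝓝 (q, α)) := by
    have : Continuous fun t : ℝ => (q + t • r, α) := by fun_prop
    simpa using (this.tendsto 0).mono_left nhdsWithin_le_nhds
  have hint : ∀ᶠ t in 𝓝[>] (0 : ℝ), q + t • r ∈ prices C :=
    ((continuous_fst.tendsto _).comp hlim).eventually (mem_interior_iff_mem_nhds.1 hq)
  have hlim' : Tendsto (fun t : ℝ => (q + t • r, α)) (𝓝[>] 0)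
      (𝓝[epi fun q => -indirectUtility C u q] (q, α)) := by
    refine tendsto_nhdsWithin_iff.2 ⟨hlim, ?_⟩
    filter_upwards [hint, self_mem_nhdsWithin] with t ht ht0
    refine mem_epi_neg_indirectUtility ⟨ht, hx.1.2.1, ?_⟩ hα
    have := mul_nonpos_of_nonneg_of_nonpos (le_of_lt ht0) hr
    have := hx.1.2.2
    simp only [add_apply, smul_apply, smul_eq_mul]
    linarith
  obtain ⟨t, ht, ht0 : 0 < t⟩ :=
    ((hlim'.eventually (hg.2 (τ / (‖r‖ + 1)) (by positivity))).and self_mem_nhdsWithin).exists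
  have e : ((q + t • r, α) - (q, α) : StrongDual ℝ X × ℝ) = t • (r, 0) := by ext <;> simp
  have hn : ‖((r, 0) : StrongDual ℝ X × ℝ)‖ = ‖r‖ := by simp [Prod.norm_def]
  rw [e, map_smul, norm_smul, Real.norm_of_nonneg ht0.le, hn, smul_eq_mul, mul_left_comm,
    mul_le_mul_iff_right₀ ht0] at ht
  have : τ / (‖r‖ + 1) * ‖r‖ ≤ τ := by
    rw [div_mul_eq_mul_div, div_le_iff₀ (by positivity)]
    nlinarith
  linarith

/-- Normals to the epigraph of `-v` induce normals to the epigraph of `-u` over the cone of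
goods, by rescaling prices so that the budget is exhausted. -/
theorem pairFunctional_mem_epsNormals {q : StrongDual ℝ X} {x : X} {α ε : ℝ}
    {g : StrongDual ℝ (StrongDual ℝ X × ℝ)} (hε : 0 ≤ ε)
    (hx : x ∈ demand C u q) (hqx : q x = 1)
    (hg : g ∈ epsNormals ε (q, α) (epi fun q => -indirectUtility C u q)) :
    pairFunctional (-(g (q, 0) • q)) (g (0, 1)) ∈ epsNormals (ε * max (‖q‖ * ‖q‖) 1) (x, α)
      (epi (fun y => -u y) ∩ ContinuousLinearMap.fst ℝ X ℝ ⁻¹' C) := by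
  have hα : (x, α) ∈ epi fun y => -u y := by
    have := hg.1
    simpa only [epi, Set.mem_ofPred_eq, hx.2] using this
  let G : X × ℝ → StrongDual ℝ X × ℝ := fun y => ((q y.1)⁻¹ • q, y.2)
  let π : X × ℝ →L[ℝ] StrongDual ℝ X × ℝ := (-q.smulRight q).prodMap (ContinuousLinearMap.id ℝ ℝ)
  have hπ_apply : ∀ y, π y = (-(q y.1 • q), y.2) := fun y => rfl
  have hGx : G (x, α) = (q, α) := by simp [G, hqx]
  have hG : HasFDerivAt G π (x, α) := by
    have h1 : HasFDerivAt (fun y : X × ℝ => q y.1) (q.comp (ContinuousLinearMap.fst ℝ X ℝ)) (x, α) :=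
      (q.comp (ContinuousLinearMap.fst ℝ X ℝ)).hasFDerivAt
    have h2 : HasFDerivAt (fun y : X × ℝ => (q y.1)⁻¹) _ (x, α) :=
      (hasDerivAt_inv (by simp [hqx])).comp_hasFDerivAt (x, α) h1
    have h3 := (h2.smul_const q).prodMk (hasFDerivAt_snd (𝕜 := ℝ) (p := (x, α)))
    refine h3.congr_fderiv ?_
    ext <;> simp [π, hqx]
  have hπ : ‖π‖ ≤ max (‖q‖ * ‖q‖) 1 := by
    refine ContinuousLinearMap.opNorm_le_bound _ (by positivity) fun y => ?_
    have h1 : ‖(π y).1‖ ≤ ‖q‖ * ‖q‖ * ‖y.1‖ := by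
      have := mul_le_mul_of_nonneg_right (q.le_opNorm y.1) (norm_nonneg q)
      rw [hπ_apply, norm_neg, norm_smul]
      linarith
    refine max_le (h1.trans ?_) ?_
    · exact mul_le_mul (le_max_left _ _) (norm_fst_le y) (norm_nonneg _) (by positivity)
    · calc ‖(π y).2‖ = 1 * ‖y.2‖ := by simp [π]
        _ ≤ _ := mul_le_mul (le_max_right _ _) (norm_snd_le y) (norm_nonneg _) (by positivity)
  have key := comp_mem_epsNormals hε (hGx.symm ▸ hg) hG hπ
    (Ω := epi (fun y => -u y) ∩ ContinuousLinearMap.fst ℝ X ℝ ⁻¹' C) ⟨hα, hx.1.2.1⟩ ?_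
  · convert key using 1
    ext y
    · have e : ((-(q y • q), 0) : StrongDual ℝ X × ℝ) = (-q y) • (q, 0) := by ext <;> simp
      simp only [hπ_apply, ContinuousLinearMap.comp_apply, ContinuousLinearMap.inl_apply,
        pairFunctional_apply, neg_apply, e, map_smul, smul_eq_mul, smul_apply]
      ring
    · simp [π]
  · have hpos : ∀ᶠ y in 𝓝 ((x, α) : X × ℝ), 0 < q y.1 := by
      have : Continuous fun y : X × ℝ => q y.1 := by fun_prop
      exact (this.tendsto (x, α)).eventually_const_lt (by simp [hqx])
    filter_upwards [self_mem_nhdsWithin, nhdsWithin_le_nhds hpos] with y hy hy0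
    refine mem_epi_neg_indirectUtility (x := y.1)
      ⟨smul_mem_prices hx.1.1 (inv_nonneg.2 hy0.le), hy.2, ?_⟩ hy.1
    simp [hy0.ne']

end Consumer

section Consumer

variable {X : Type*} [NormedAddCommGroup X] [NormedSpace ℝ X] {C : ProperCone ℝ X} {u : X → EReal}

/-- Limiting normals `(f, μ)` to the epigraph of `-v` in terms of limiting normals to the epigraph
of `-u` over the cone of goods. -/
theorem exists_demand_of_mem_limitingNormalCone [FiniteDimensional ℝ X] (hnsc : NonSatiety C u)
    (husc : UpperSemicontinuousOn u (C : Set X)) {p : StrongDual ℝ X}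
    (hp : p ∈ interior (prices C)) (htop : -indirectUtility C u p ≠ ⊤)
    (hbot : -indirectUtility C u p ≠ ⊥) {f : StrongDual ℝ (StrongDual ℝ X)} {μ : ℝ}
    (hf : pairFunctional f μ ∈ limitingNormalCone (p, (-indirectUtility C u p).toReal)
      (epi fun q => -indirectUtility C u q)) :
    ∃ x ∈ demand C u p, ∃ c : ℝ, 0 ≤ c ∧ f = NormedSpace.inclusionInDoubleDual ℝ X (c • x) ∧
      pairFunctional (-(c • p)) μ ∈ limitingNormalCone (x, (-u x).toReal)
        (epi (fun y => -u y) ∩ ContinuousLinearMap.fst ℝ X ℝ ⁻¹' C) := by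
  obtain ⟨-, ε, z, g, hε0, hε, hz, hzt, hg, hN⟩ := hf
  replace hg := tendsto_dual_of_tendsto_apply hg
  have hqt : Tendsto (fun k => (z k).1) atTop (𝓝 p) := (continuous_fst.tendsto _).comp hzt
  have hαt : Tendsto (fun k => (z k).2) atTop (𝓝 (-indirectUtility C u p).toReal) :=
    (continuous_snd.tendsto _).comp hzt
  obtain ⟨R, hR⟩ := exists_norm_le_of_mem_interior_prices hp
  have hint : ∀ᶠ k in atTop, (z k).1 ∈ interior (prices C) :=
    hqt.eventually (isOpen_interior.mem_nhds hp)
  have hex : ∀ k, ∃ x, (z k).1 ∈ interior (prices C) → x ∈ demand C u (z k).1 := fun k => by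
    by_cases h : (z k).1 ∈ interior (prices C)
    · exact (demand_nonempty husc h).imp fun x hx _ => hx
    · exact ⟨0, fun h' => (h h').elim⟩
  choose x hx using hex
  have hbdd : ∀ᶠ k in atTop, x k ∈ Metric.closedBall (0 : X) R := by
    filter_upwards [hint, hqt.eventually hR] with k h1 h2
    simpa using h2 _ (hx k h1).1.2.1 (hx k h1).1.2.2
  obtain ⟨x₀, -, φ, hφ, hxt⟩ := tendsto_subseq_of_frequently_bounded
    Metric.isBounded_closedBall hbdd.frequently
  have ht := hφ.tendsto_atTop
  have hφint := ht.eventually hint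
  have hev : Tendsto (fun k => (z (φ k)).1 (x (φ k))) atTop (𝓝 (p x₀)) :=
    tendsto_clm_apply (hqt.comp ht) hxt
  have hpx : p x₀ = 1 := by
    refine tendsto_nhds_unique hev (tendsto_const_nhds.congr' ?_)
    filter_upwards [hφint] with k hk
    exact (apply_eq_one_of_mem_demand hnsc (hx _ hk)).symm
  have hxC : ∀ᶠ k in atTop, x (φ k) ∈ (C : Set X) := hφint.mono fun k hk => (hx _ hk).1.2.1
  have hx₀C : x₀ ∈ C := C.isClosed.mem_of_tendsto hxt hxC
  have hx₀B : x₀ ∈ budget C p := ⟨interior_subset hp, hx₀C, hpx.le⟩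
  have hv : indirectUtility C u p = ((-(-indirectUtility C u p).toReal : ℝ) : EReal) := by
    rw [EReal.coe_neg, EReal.coe_toReal htop hbot, neg_neg]
  have hx₀D : x₀ ∈ demand C u p := by
    refine ⟨hx₀B, (le_iSup₂ (f := fun x _ => u x) x₀ hx₀B).antisymm (le_of_not_gt fun hlt => ?_)⟩
    obtain ⟨c, hc1, hc2⟩ := exists_between hlt
    change c < indirectUtility C u p at hc2
    rw [hv] at hc2
    have h1 : ∀ᶠ k in atTop, u (x (φ k)) < c :=
      (tendsto_nhdsWithin_iff.2 ⟨hxt, hxC⟩).eventually (husc x₀ hx₀C c hc1)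
    have h2 : ∀ᶠ k in atTop, c < ((-(z (φ k)).2 : ℝ) : EReal) :=
      ((continuous_coe_real_ereal.tendsto _).comp
        ((hαt.comp ht).neg)).eventually (lt_mem_nhds hc2)
    obtain ⟨k, h1, h2, hk⟩ := (h1.and (h2.and hφint)).exists
    have h3 : -indirectUtility C u (z (φ k)).1 ≤ ((z (φ k)).2 : EReal) := hz (φ k)
    rw [← (hx _ hk).2, EReal.neg_le, ← EReal.coe_neg] at h3
    exact (h1.trans h2).not_ge h3
  have hgr : ∀ {r : ℕ → StrongDual ℝ X} {r₀ : StrongDual ℝ X}, Tendsto r atTop (𝓝 r₀) →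
      (∀ᶠ k in atTop, r k (x (φ k)) ≤ 0) → f r₀ ≤ 0 := by
    intro r r₀ hr hrx
    have h1 : Tendsto (fun k => g (φ k) (r k, 0)) atTop (𝓝 (f r₀)) := by
      simpa using tendsto_clm_apply (hg.comp ht) (hr.prodMk_nhds (tendsto_const_nhds (x := (0 : ℝ))))
    have h2 : Tendsto (fun k => ε (φ k) * ‖r k‖) atTop (𝓝 0) := by
      simpa using (hε.comp ht).mul hr.norm
    refine le_of_tendsto_of_tendsto h1 h2 ?_
    filter_upwards [hφint, hrx] with k hk hrk
    exact apply_le_of_mem_epsNormals hk (hx _ hk) (hN _) hrk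
  have hle : ∀ r : StrongDual ℝ X, f (r - r x₀ • p) ≤ 0 := fun r => by
    refine hgr (r := fun k => r - r (x (φ k)) • (z (φ k)).1) ?_ ?_
    · exact tendsto_const_nhds.sub (((r.continuous.tendsto _).comp hxt).smul (hqt.comp ht))
    · filter_upwards [hφint] with k hk
      simp [apply_eq_one_of_mem_demand hnsc (hx _ hk)]
  have hfr : ∀ r : StrongDual ℝ X, f r = f p * r x₀ := fun r => by
    have h1 := hle r
    have h2 := hle (-r)
    simp only [map_sub, map_neg, map_smul, smul_eq_mul, neg_apply] at h1 h2
    linarith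
  have hc : 0 ≤ f p := by
    have h := hgr (hqt.comp ht).neg <| hφint.mono fun k hk => by
      simp [apply_eq_one_of_mem_demand hnsc (hx _ hk)]
    simpa using h
  refine ⟨x₀, hx₀D, f p, hc, ?_, ?_⟩
  · ext r
    simp [hfr r]
  · have hα₀ : (-u x₀).toReal = (-indirectUtility C u p).toReal := by rw [hx₀D.2]
    have hux : -u x₀ = ((-u x₀).toReal : EReal) := by
      rw [hα₀, EReal.coe_toReal htop hbot, hx₀D.2]
    have hgq : Tendsto (fun k => g (φ k) ((z (φ k)).1, 0)) atTop (𝓝 (f p)) := by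
      simpa using tendsto_clm_apply (hg.comp ht)
        ((hqt.comp ht).prodMk_nhds (tendsto_const_nhds (x := (0 : ℝ))))
    have hgμ : Tendsto (fun k => g (φ k) (0, 1)) atTop (𝓝 μ) := by
      simpa using tendsto_clm_apply (hg.comp ht) (tendsto_const_nhds (x := ((0, 1) : StrongDual ℝ X × ℝ)))
    refine mem_limitingNormalCone_of_tendsto ⟨hux.le, hx₀C⟩
      (ε := fun k => ε (φ k) * max (‖(z (φ k)).1‖ * ‖(z (φ k)).1‖) 1)
      (z := fun k => (x (φ k), (z (φ k)).2))
      (g := fun k => pairFunctional (-(g (φ k) ((z (φ k)).1, 0) • (z (φ k)).1)) (g (φ k) (0, 1)))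
      (fun k => mul_nonneg (hε0 _) (by positivity)) ?_ ?_ ?_ (Eventually.frequently ?_)
    · have hn := (hqt.comp ht).norm
      simpa using (hε.comp ht).mul ((hn.mul hn).max tendsto_const_nhds)
    · rw [hα₀]
      exact Tendsto.prodMk_nhds hxt (hαt.comp ht)
    · refine tendsto_dual_of_tendsto_apply fun w => ?_
      have h1 : Tendsto (fun k => (z (φ k)).1 w.1) atTop (𝓝 (p w.1)) :=
        tendsto_clm_apply (hqt.comp ht) tendsto_const_nhds
      simpa using ((hgq.mul h1).neg).add (hgμ.mul_const w.2)
    · filter_upwards [hφint] with k hk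
      exact pairFunctional_mem_epsNormals (hε0 _) (hx _ hk)
        (apply_eq_one_of_mem_demand hnsc (hx _ hk)) (hN _)

/-- Limiting normals to the epigraph of `-u` over the cone of goods split under the qualification
condition. -/
theorem exists_pairFunctional_sub_mem_limitingNormalCone [FiniteDimensional ℝ X] {x : X}
    (htop : u x ≠ ⊤) (hbot : u x ≠ ⊥) (husc : ∀ᶠ y in 𝓝 x, UpperSemicontinuousAt u y)
    (hqual : Qualification C u x) {f : StrongDual ℝ X} {μ : ℝ}
    (hf : pairFunctional f μ ∈ limitingNormalCone (x, (-u x).toReal)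
      (epi (fun y => -u y) ∩ ContinuousLinearMap.fst ℝ X ℝ ⁻¹' C)) :
    ∃ a ∈ limitingNormalCone x (C : Set X),
      pairFunctional (f - a) μ ∈ limitingNormalCone (x, (-u x).toReal) (epi fun y => -u y) := by
  obtain ⟨r, hr, hball⟩ := Metric.nhds_basis_closedBall.mem_iff.1 husc
  have hsub : ∀ (g a : StrongDual ℝ X) (c : ℝ),
      pairFunctional g c - a.comp (ContinuousLinearMap.fst ℝ X ℝ) = pairFunctional (g - a) c :=
    fun g a c => by ext <;> simp
  have hker : ∀ a ∈ limitingNormalCone x (C : Set X),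
      -a.comp (ContinuousLinearMap.fst ℝ X ℝ) ∈
        limitingNormalCone (x, (-u x).toReal) (epi fun y => -u y) → a = 0 := by
    intro a ha hna
    have hmem : a ∈ singularUpperSubdiff u x ∩ limitingNormalCone x (C : Set X) := by
      refine ⟨⟨by simpa using hbot, by simpa using htop, ?_⟩, ha⟩
      convert hna using 1
      ext <;> simp
    rw [hqual] at hmem
    exact hmem
  obtain ⟨a, ha, hfa⟩ := exists_sub_comp_mem_limitingNormalCone (ContinuousLinearMap.fst ℝ X ℝ) hf
    (K := Prod.fst ⁻¹' Metric.closedBall x r)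
    (continuous_fst.continuousAt (Metric.closedBall_mem_nhds x hr))
    (isClosed_epi_neg_inter Metric.isClosed_closedBall fun y hy =>
      (hball hy).upperSemicontinuousWithinAt _) C.isClosed hker
  exact ⟨a, ha, hsub f a μ ▸ hfa⟩

end Consumer

end ConsumerProblem

theorem mainTheorem9 {X : Type*} [NormedAddCommGroup X] [NormedSpace ℝ X] [FiniteDimensional ℝ X]
    (C : ProperCone ℝ X) (u : X → EReal)
    (hfin : ∀ x ∈ C, u x ≠ ⊤ ∧ u x ≠ ⊥)
    (hnsc : ConsumerProblem.NonSatiety C u)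
    (husc : UpperSemicontinuousOn u (C : Set X))
    (p : StrongDual ℝ X) (hp : p ∈ interior (ConsumerProblem.prices C))
    (huscD : ∀ x ∈ ConsumerProblem.demand C u p, ∀ᶠ y in 𝓝 x, UpperSemicontinuousAt u y)
    (hqual : ∀ x ∈ ConsumerProblem.demand C u p, ConsumerProblem.Qualification C u x) :
    ConsumerProblem.limitingSubdiff (fun q => -ConsumerProblem.indirectUtility C u q) p ⊆
      (⋃ x ∈ ConsumerProblem.demand C u p, ⋃ f ∈ ConsumerProblem.limitingUpperSubdiff u x,
        {ξ | ∃ c : ℝ, 0 ≤ c ∧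
          f - c • p ∈ ConsumerProblem.limitingNormalCone x (C : Set X) ∧
          ξ = NormedSpace.inclusionInDoubleDual ℝ X (c • x)}) ∧
    ConsumerProblem.singularSubdiff (fun q => -ConsumerProblem.indirectUtility C u q) p ⊆
      (⋃ x ∈ ConsumerProblem.demand C u p, ⋃ f ∈ ConsumerProblem.singularUpperSubdiff u x,
        {ξ | ∃ c : ℝ, 0 ≤ c ∧
          f - c • p ∈ ConsumerProblem.limitingNormalCone x (C : Set X) ∧
          ξ = NormedSpace.inclusionInDoubleDual ℝ X (c • x)}) := by
  open ConsumerProblem in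
  have key : ∀ (μ : ℝ) (ξ : StrongDual ℝ (StrongDual ℝ X)), -indirectUtility C u p ≠ ⊤ →
      -indirectUtility C u p ≠ ⊥ →
      pairFunctional ξ μ ∈ limitingNormalCone (p, (-indirectUtility C u p).toReal)
        (epi fun q => -indirectUtility C u q) →
      ∃ x ∈ demand C u p, ∃ f : StrongDual ℝ X, (-u x ≠ ⊤ ∧ -u x ≠ ⊥ ∧
        pairFunctional (-f) μ ∈ limitingNormalCone (x, (-u x).toReal) (epi fun y => -u y)) ∧
        ∃ c : ℝ, 0 ≤ c ∧ f - c • p ∈ limitingNormalCone x (C : Set X) ∧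
          ξ = NormedSpace.inclusionInDoubleDual ℝ X (c • x) := by
    intro μ ξ htop hbot hξ
    obtain ⟨x, hx, c, hc, hξc, hN⟩ :=
      exists_demand_of_mem_limitingNormalCone hnsc husc hp htop hbot hξ
    obtain ⟨htop', hbot'⟩ := hfin x hx.1.2.1
    obtain ⟨a, ha, haN⟩ := exists_pairFunctional_sub_mem_limitingNormalCone htop' hbot'
      (huscD x hx) (hqual x hx) hN
    refine ⟨x, hx, c • p + a, ⟨by simpa using hbot', by simpa using htop', ?_⟩, c, hc,
      by simpa using ha, hξc⟩
    rwa [neg_add']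
  constructor
  all_goals
    rintro ξ ⟨htop, hbot, hξ⟩
    obtain ⟨x, hx, f, hf, hc⟩ := key _ ξ htop hbot hξ
    exact Set.mem_iUnion₂.2 ⟨x, hx, Set.mem_iUnion₂.2 ⟨f, hf, hc⟩⟩
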